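/- **Setting.** There are finitely many caches $i\in C$, a content server $0$, and finitely many unit-size objects $k\in O$. Cache $i$ has storage limit $s_i$ and upload limit $u_i$ (nonnegative integers), cache $j$ makes $r_{jk}\in\mathbb{Z}_{\ge 0}$ requests for object $k$, and $Y_i\subseteq O$ is the set of objects that cache $i$ holds from the previous epoch. Put $\tau_i=u_i/s_i$ ($\tau_i=0$ if $s_i=0$) and $\tau_{\max}=\max_i\tau_i$. A *fractional solution* consists of reals $\hat x_{ijk}\ge 0$ ($i\in C\cup\{0\}$, $j\in C$, $k\in O$: requests for $k$ at $j$ served by $i$) and $\hat y_{ik}\ge 0$ ($i\in C$, $k\in O$: amount of $k$ stored at $i$) with $$\sum_{j\ne i}\hat x_{ijk}\le\tau_i\hat y_{ik},\qquad \sum_k\hat y_{ik}\le s_i,\qquad \sum_{i\in C\cup\{0\}}\hat x_{ijk}=r_{jk},\qquad \hat x_{ijk}\le r_{jk}\hat y_{ik}\ (i\in C),$$ and its *fractional cost* is $$\sum_{j,k}\hat x_{0jk}+\sum_{i}\sum_{k\notin Y_i}\frac{\hat y_{ik}}{\hat y_{ik}+1}.$$ **Rounding.** Let $\hat n_k=\sum_{i:\hat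 y_{ik}<1/2}\hat y_{ik}$. Nonnegative integers $y_{ik}$ (numbers of copies) are a *rounding* of $\hat y$ if (a) $y_{ik}=\lceil\hat y_{ik}\rceil$ whenever $\hat y_{ik}\ge 1/2$; (b) if $\hat n_k<1/2$, then $y_{ik}=0$ for all $i$ with $\hat y_{ik}<1/2$; (c) if $\hat n_k\ge 1/2$, then $\sum_{i:\hat y_{ik}<1/2}y_{ik}=\lceil\hat n_k\rceil$; (d) $y_{ik}=0$ whenever $\hat y_{ik}=0$. Cache $i$ then contains the object set $F_i=\{k:y_{ik}\ge 1\}$. **Theorem.** For every fractional solution $(\hat x,\hat y)$ (in particular for one found by branch and bound) there are a rounding $y$ of $\hat y$ and nonnegative integers $x_{ijk}$ ($i\in C\cup\{0\}$, $j\in C$, $k\in O$) that serve all requests, $\sum_{i\in C\cup\{0\}}x_{ijk}=r_{jk}$, from caches that contain the object ($x_{ijk}>0$ with $i\in C$ implies $k\in F_i$) or from the server, such that 1. the cost, with placement charged only for objects not cached in the previous epoch, is at most $16$ times the fractional cost: $$\sum_{j,k}x_{0jk}+\sum_i|F_i\setminus Y_i|\le 16\Big(\sum_{j,k}\hat x_{0jk}+\sum_{i}\sum_{k\notin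 Y_i}\frac{\hat y_{ik}}{\hat y_{ik}+1}\Big);$$ 2. $\sum_k y_{ik}\le 4s_i+2$ for every cache $i$; 3. the upload of every cache $i$ satisfies $\sum_{j\ne i}\sum_k x_{ijk}\le 8u_i+4\tau_{\max}$; 4. let $O_j$, for each cache $j$, be any set of $\min(s_j,|O|)$ objects with largest demands $r_{jk}$ at $j$; if these are stored at $j$ in addition and all requests of $j$ for objects of $O_j$ are served locally, then all requests are still served from caches that contain the object or from the server, the total storage used at cache $i$ is $|F_i\cup O_i|\le 5s_i+2$, the upload of cache $i$ is still at most $8u_i+4\tau_{\max}$, the number of requests served by the server does not increase, and the number of requests of each cache $j$ that are not served locally is at most the fractional one, $\sum_k\sum_{i\in C\cup\{0\},\,i\ne j}\hat x_{ijk}$. -/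

import Mathlib

open scoped BigOperators

/-- One epoch of the data placement problem with unit-size objects.  `ι` is the set of caches and
`κ` the set of objects.  `storage` and `upload` are the limits `s` and `u`, `demand j k` is the
number of requests `r` for object `k` at cache `j`, and `prev i` is the set of objects that cache
`i` already holds from the previous epoch. -/
structure CacheInstance (ι κ : Type*) where
  storage : ι → ℕ
  upload : ι → ℕ
  demand : ι → κ → ℕ
  prev : ι → Finset κ

namespace CacheInstance

variable {ι κ : Type*} [Fintype ι] [Fintype κ] [DecidableEq ι] [DecidableEq κ]

/-- `τ i = u i / s i`. -/
noncomputable def tau (I : CacheInstance ι κ) (i : ι) : ℝ := (I.upload i : ℝ) / (I.storage i : ℝ)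

/-- The largest `τ i`. -/
noncomputable def tauMax (I : CacheInstance ι κ) : ℝ := ⨆ i, I.tau i

/-- Feasible points of the continuous relaxation of the `τ`-constrained program.  In
`x i j k` the provider `i : Option ι` is a cache (`some`) or the content server (`none`),
`j` is the requesting cache and `k` the object; `y i k` is the amount of `k` stored at `i`. -/
structure FracFeasible (I : CacheInstance ι κ) (x : Option ι → ι → κ → ℝ) (y : ι → κ → ℝ) :
    Prop where
  x_nonneg : ∀ i j k, 0 ≤ x i j k
  y_nonneg : ∀ i k, 0 ≤ y i k
  copy_limit : ∀ i k, ∑ j with j ≠ i, x (some i) j k ≤ I.tau i * y i k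
  storage_limit : ∀ i, ∑ k, y i k ≤ (I.storage i : ℝ)
  all_served : ∀ j k, ∑ i, x i j k = (I.demand j k : ℝ)
  stored : ∀ i j k, x (some i) j k ≤ (I.demand j k : ℝ) * y i k

/-- The objective of the relaxed program: requests served by the server, plus `y / (y + 1)` for
every object that is not already cached from the previous epoch. -/
noncomputable def fracCost (I : CacheInstance ι κ) (x : Option ι → ι → κ → ℝ) (y : ι → κ → ℝ) :
    ℝ :=
  (∑ j, ∑ k, x none j k) + ∑ i, ∑ k with k ∉ I.prev i, y i k / (y i k + 1)

/-- Amount downloaded by cache `j` in a fractional routing. -/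
noncomputable def fracDownload (x : Option ι → ι → κ → ℝ) (j : ι) : ℝ :=
  ∑ k, ∑ i with i ≠ some j, x i j k

/-- Total amount of object `k` in the caches that hold less than half a copy of it. -/
noncomputable def smallMass (yh : ι → κ → ℝ) (k : κ) : ℝ :=
  ∑ i with yh i k < 1 / 2, yh i k

/-- `y` is a placement (numbers of copies) that the rounding procedure can produce from the
fractional placement `yh`: entries `≥ 1/2` are rounded up; the small entries of an object are
closed if their total mass is less than `1/2`, and otherwise they are replaced by an integral
assignment of `⌈mass⌉` copies to caches holding a positive small fraction of the object. -/
structure IsRounding (yh : ι → κ → ℝ) (y : ι → κ → ℕ) : Prop where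
  round_up : ∀ i k, 1 / 2 ≤ yh i k → y i k = ⌈yh i k⌉₊
  closed : ∀ i k, yh i k < 1 / 2 → smallMass yh k < 1 / 2 → y i k = 0
  opened : ∀ k, 1 / 2 ≤ smallMass yh k →
    ∑ i with yh i k < 1 / 2, y i k = ⌈smallMass yh k⌉₊
  support : ∀ i k, yh i k = 0 → y i k = 0

/-- The set of objects in cache `i`; several copies of one object count once. -/
def contents (y : ι → κ → ℕ) (i : ι) : Finset κ := {k | 0 < y i k}

/-- `x` is an integral routing that serves every request, with caches serving only objects that
they contain. -/
structure Serves (I : CacheInstance ι κ) (F : ι → Finset κ) (x : Option ι → ι → κ → ℕ) :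
    Prop where
  all_served : ∀ j k, ∑ i, x i j k = I.demand j k
  stored : ∀ i j k, x (some i) j k ≠ 0 → k ∈ F i

/-- Number of requests served by the content server. -/
def serverLoad (x : Option ι → ι → κ → ℕ) : ℕ := ∑ j, ∑ k, x none j k

/-- Number of requests of other caches that cache `i` serves. -/
def uploaded (x : Option ι → ι → κ → ℕ) (i : ι) : ℕ := ∑ j with j ≠ i, ∑ k, x (some i) j k

/-- Number of requests of cache `j` that are not served locally. -/
def downloaded (x : Option ι → ι → κ → ℕ) (j : ι) : ℕ := ∑ k, ∑ i with i ≠ some j, x i j k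

/-- One unit for every object placed in a cache that did not hold it in the previous epoch. -/
def placementCost (I : CacheInstance ι κ) (F : ι → Finset κ) : ℕ := ∑ i, (F i \ I.prev i).card

/-- `O j` consists of `s j` objects (all objects, if there are fewer) with the largest demands
at `j`. -/
def IsTop (I : CacheInstance ι κ) (O : ι → Finset κ) : Prop :=
  ∀ j, (O j).card = min (I.storage j) (Fintype.card κ) ∧
    ∀ k ∈ O j, ∀ k' ∉ O j, I.demand j k' ≤ I.demand j k

/-- The routing obtained from `x` by serving at `j` itself all requests of `j` for objects of
`O j`. -/
def localize (I : CacheInstance ι κ) (O : ι → Finset κ) (x : Option ι → ι → κ → ℕ) :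
    Option ι → ι → κ → ℕ :=
  fun i j k => if k ∈ O j then (if i = some j then I.demand j k else 0) else x i j k

end CacheInstance

/-! Call an entry of `yh` small if it is below 1/2. Large entries are rounded up at the price of a
factor 2. The small entries of one object are the crux. Let `n` be their mass and `D` the demand of
their caches.

If `n < 1/2`, these caches together serve at most `n * D ≤ D / 2` of that demand, so the server and
the large caches already carry half of it; closing the small entries costs them a factor 2. If `n ≥
1/2`, opening cache `i` is worth `2 * τ i + r i`: a doubled upload allowance, and its own requests
become local. The `⌈n⌉ ≤ 2 * n` copies are first spread fractionally, greedily by worth and with at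
most `min 1 (4 * y i)` in cache `i`, and cut into unit slots of decreasing worth. A choice in one
slot is worth at least the average of the next, so only the first slot is lost. Hence every choice
along the supports covers the demand, with the same factor 2 on the server and the large caches
(`exists_object_slots`).

Since every choice works, all objects can be rounded together: a Birkhoff argument
(`exists_placement`) picks the choices so that cache budgets and placement cost are those of the
fractional slots, up to one ceiling per cache. The resulting capacities cover each object separately
and sit only on caches containing it, which yields Hall's condition for integral routing
(`exists_routing`). The cost factors are 2 for the server and 6 for placement. For the last claim, a
fractional knapsack bound shows that no fractional solution serves more requests locally than the
objects of largest demand. -/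

/-! ### Greedy splitting into unit slots -/

/-- A vector `z` dominates a vector of prescribed total mass that uses the entries of largest
weight first. -/
theorem exists_greedy_subvector {ι : Type*} [Fintype ι] [DecidableEq ι] (w z : ι → ℝ)
    (hz : ∀ i, 0 ≤ z i) (m : ℝ) (hm : 0 ≤ m) (hmz : m ≤ ∑ i, z i) :
    ∃ p : ι → ℝ, (∀ i, 0 ≤ p i) ∧ (∀ i, p i ≤ z i) ∧ ∑ i, p i = m ∧
      ∀ i j, 0 < p i → p j < z j → w j ≤ w i := by
  suffices H : ∀ (n : ℕ) (s : Finset ι), s.card = n → ∀ m : ℝ, 0 ≤ m → m ≤ ∑ i ∈ s, z i →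
      ∃ p : ι → ℝ, (∀ i, 0 ≤ p i) ∧ (∀ i, p i ≤ z i) ∧ (∀ i ∉ s, p i = 0) ∧ ∑ i ∈ s, p i = m ∧
        ∀ i ∈ s, ∀ j ∈ s, 0 < p i → p j < z j → w j ≤ w i by
    obtain ⟨p, h0, h1, -, h3, h4⟩ := H _ Finset.univ rfl m hm hmz
    exact ⟨p, h0, h1, h3, fun i j => h4 i (Finset.mem_univ _) j (Finset.mem_univ _)⟩
  intro n
  induction n with
  | zero =>
    intro s hs m hm hmz
    rw [Finset.card_eq_zero] at hs
    subst hs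
    refine ⟨fun _ => 0, fun _ => le_rfl, hz, fun _ _ => rfl, ?_, by simp⟩
    simp at hmz ⊢
    linarith
  | succ n ih =>
    intro s hs m hm hmz
    have hne : s.Nonempty := by rw [← Finset.card_pos]; omega
    obtain ⟨a, ha, hamax⟩ := Finset.exists_max_image s w hne
    by_cases hza : m ≤ z a
    · refine ⟨Pi.single a m, ?_, ?_, ?_, ?_, ?_⟩
      · intro i
        by_cases h : i = a
        · subst h; simpa using hm
        · simp [h]
      · intro i
        by_cases h : i = a
        · subst h; simpa using hza
        · simpa [h] using hz i
      · intro i hi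
        have : i ≠ a := fun h => hi (h ▸ ha)
        simp [this]
      · simp [ha]
      · intro i hi j hj hp _
        by_cases h : i = a
        · subst h; exact hamax j hj
        · simp [h] at hp
    · push Not at hza
      have hsum := Finset.add_sum_erase s z ha
      obtain ⟨p, h0, h1, h2, h3, h4⟩ := ih (s.erase a) (by rw [Finset.card_erase_of_mem ha]; omega)
        (m - z a) (by linarith) (by linarith)
      refine ⟨Function.update p a (z a), ?_, ?_, ?_, ?_, ?_⟩
      · intro i
        by_cases h : i = a
        · subst h; simpa using hz i
        · simpa [h] using h0 i
      · intro i
        by_cases h : i = a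
        · subst h; simp
        · simpa [h] using h1 i
      · intro i hi
        have : i ≠ a := fun h => hi (h ▸ ha)
        simp [this, h2 i (fun h => hi (Finset.mem_of_mem_erase h))]
      · rw [← Finset.add_sum_erase s _ ha]
        have : ∑ x ∈ s.erase a, Function.update p a (z a) x = ∑ x ∈ s.erase a, p x := by
          refine Finset.sum_congr rfl fun x hx => ?_
          simp [Finset.ne_of_mem_erase hx]
        rw [this, h3]
        simp
      · intro i hi j hj hp hq
        by_cases h : i = a
        · subst h; exact hamax j hj
        by_cases h' : j = a
        · subst h'; simp at hq
        simp only [Function.update_of_ne h, Function.update_of_ne h'] at hp hq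
        exact h4 i (Finset.mem_erase.2 ⟨h, hi⟩) j (Finset.mem_erase.2 ⟨h', hj⟩) hp hq

/-- A vector of mass `N + 1` splits into unit vectors of decreasing weight, so that choosing one
supporting index from each of them loses at most the first unit vector, and gains the smallest
weight. -/
theorem exists_sorted_slots {ι : Type*} [Fintype ι] [DecidableEq ι] (w : ι → ℝ) (l : ℝ) (N : ℕ) :
    ∀ z : ι → ℝ, (∀ i, 0 ≤ z i) → ∑ i, z i = (N : ℝ) + 1 → (∀ i, 0 < z i → l ≤ w i) →
    ∃ Z : Fin (N + 1) → ι → ℝ, (∀ t i, 0 ≤ Z t i) ∧ (∀ t, ∑ i, Z t i = 1) ∧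
      (∀ i, ∑ t, Z t i = z i) ∧
      ∀ f : Fin (N + 1) → ι, (∀ t, 0 < Z t (f t)) →
        ∑ i, z i * w i - ∑ i, Z 0 i * w i + l ≤ ∑ t, w (f t) := by
  induction N with
  | zero =>
    intro z hz hs hl
    refine ⟨fun _ => z, fun _ => hz, fun _ => by simpa using hs, fun i => by simp, ?_⟩
    intro f hf
    have := hl _ (hf 0)
    simpa using this
  | succ N ih =>
    intro z hz hs hl
    obtain ⟨p, h0, h1, h2, h3⟩ := exists_greedy_subvector w z hz 1 zero_le_one (by
      rw [hs]; push_cast; linarith [(Nat.cast_nonneg N : (0:ℝ) ≤ N)])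
    obtain ⟨Z, g0, g1, g2, g3⟩ := ih (fun i => z i - p i) (fun i => by linarith [h1 i]) (by
      rw [Finset.sum_sub_distrib, hs, h2]; push_cast; ring) (fun i hi => hl i (by
        have := h0 i
        linarith))
    refine ⟨Fin.cons p Z, ?_, ?_, ?_, ?_⟩
    · intro t
      refine Fin.cases ?_ (fun t => ?_) t
      · exact h0
      · exact g0 t
    · intro t
      refine Fin.cases ?_ (fun t => ?_) t
      · exact h2
      · exact g1 t
    · intro i
      rw [Fin.sum_univ_succ]
      simp [g2]
    · intro f hf
      rw [Fin.sum_univ_succ]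
      have hp0 : 0 < p (f 0) := hf 0
      have hrest := g3 (fun t => f t.succ) (fun t => hf t.succ)
      -- An index with mass in the next slot was not exhausted by `p`, so by greediness it weighs no
      -- more than any index in the support of `p`. Thus each choice pays for the average of the
      -- following slot.
      have hfirst : ∑ i, Z 0 i * w i ≤ w (f 0) := by
        calc ∑ i, Z 0 i * w i ≤ ∑ i, Z 0 i * w (f 0) := by
              refine Finset.sum_le_sum fun i _ => ?_
              rcases (g0 0 i).eq_or_lt with h | h
              · simp [← h]
              · refine mul_le_mul_of_nonneg_left (h3 _ _ hp0 ?_) h.le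
                have : Z 0 i ≤ z i - p i := by
                  rw [← g2 i]
                  exact Finset.single_le_sum (f := fun t => Z t i) (fun t _ => g0 t i)
                    (Finset.mem_univ 0)
                linarith
          _ = w (f 0) := by rw [← Finset.sum_mul, g1, one_mul]
      simp only [Fin.cons_zero, sub_mul, Finset.sum_sub_distrib] at hrest ⊢
      linarith

/-- A splitting of a vector of mass `N` with entries at most one, in which entries equal to one
form slots of their own. -/
theorem exists_slots {ι : Type*} [Fintype ι] [DecidableEq ι] (w : ι → ℝ) (l : ℝ) (N : ℕ) :
    ∀ z : ι → ℝ, (∀ i, 0 ≤ z i) → (∀ i, z i ≤ 1) → ∑ i, z i = (N : ℝ) →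
      (∀ i, 0 < z i → l ≤ w i) →
    ∃ (Z : Fin N → ι → ℝ) (p : ι → ℝ), (∀ t i, 0 ≤ Z t i) ∧ (∀ t, ∑ i, Z t i = 1) ∧
      (∀ i, ∑ t, Z t i = z i) ∧ (∀ i, 0 ≤ p i) ∧ (∀ i, p i ≤ z i) ∧ ∑ i, p i ≤ 1 ∧
      (∀ i, z i = 1 → p i = 0) ∧
      ∀ f : Fin N → ι, (∀ t, 0 < Z t (f t)) →
        ∑ i, z i * w i - ∑ i, p i * w i + l * ∑ i, p i ≤ ∑ t, w (f t) := by
  induction N with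
  | zero =>
    intro z hz _ hs _
    have hz0 : ∀ i, z i = 0 := fun i =>
      (Finset.sum_eq_zero_iff_of_nonneg fun i _ => hz i).1 (by simpa using hs) i (Finset.mem_univ _)
    exact ⟨fun _ _ => 0, fun _ => 0, by simp, by simp, by simp [hz0], by simp, by simp [hz0],
      by simp, by simp, by simp [hz0]⟩
  | succ N ih =>
    intro z hz hz1 hs hl
    -- In a slot consisting of one full entry the choice is forced and nothing is lost. Peeling
    -- these off first makes the loss vector `p` vanish on full entries.
    by_cases hfull : ∃ a, z a = 1
    · obtain ⟨a, ha⟩ := hfull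
      have hupd : ∀ i, Function.update z a 0 i = z i - (Pi.single a 1 : ι → ℝ) i := by
        intro i
        by_cases h : i = a
        · subst h; simp [ha]
        · simp [h]
      obtain ⟨Z, p, g0, g1, g2, g3, g4, g5, g6, g7⟩ := ih (Function.update z a 0)
        (fun i => by
          by_cases h : i = a
          · subst h; simp
          · simpa [h] using hz i)
        (fun i => by
          by_cases h : i = a
          · subst h; simp
          · simpa [h] using hz1 i)
        (by simp only [hupd, Finset.sum_sub_distrib, hs]; push_cast; simp)
        (fun i hi => by
          by_cases h : i = a
          · subst h; simp at hi
          · exact hl i (by simpa [h] using hi))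
      have hpa : p a = 0 := le_antisymm (by simpa using g4 a) (g3 a)
      refine ⟨Fin.cons (Pi.single a 1) Z, p, ?_, ?_, ?_, g3, ?_, g5, ?_, ?_⟩
      · intro t
        refine Fin.cases (fun i => ?_) (fun t => ?_) t
        · by_cases h : i = a
          · subst h; simp
          · simp [h]
        · exact g0 t
      · intro t
        refine Fin.cases ?_ (fun t => ?_) t
        · simp
        · exact g1 t
      · intro i
        rw [Fin.sum_univ_succ]
        simp [g2, hupd]
      · intro i
        by_cases h : i = a
        · subst h; rw [hpa]; exact hz i
        · simpa [h] using g4 i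
      · intro i hi
        by_cases h : i = a
        · subst h; exact hpa
        · exact g6 i (by simpa [h] using hi)
      · intro f hf
        have hrest := g7 (fun t => f t.succ) (fun t => hf t.succ)
        have h0 : f 0 = a := by
          have := hf 0
          by_contra h
          simp [h] at this
        rw [Fin.sum_univ_succ, h0]
        simp only [hupd, sub_mul, Finset.sum_sub_distrib] at hrest
        have : ∑ i, (Pi.single a 1 : ι → ℝ) i * w i = w a := by
          simp [Pi.single_apply]
        linarith
    · push Not at hfull
      obtain ⟨Z, g0, g1, g2, g3⟩ := exists_sorted_slots w l N z hz (by rw [hs]; push_cast; ring) hl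
      refine ⟨Z, Z 0, g0, g1, g2, g0 0, ?_, (g1 0).le, fun i hi => absurd hi (hfull i), ?_⟩
      · intro i
        rw [← g2 i]
        exact Finset.single_le_sum (f := fun t => Z t i) (fun t _ => g0 t i) (Finset.mem_univ 0)
      · intro f hf
        rw [g1 0, mul_one]
        exact g3 f hf

/-! ### Rounding fractional assignments by Birkhoff's theorem -/

/-- A fractional assignment of rows to columns with integral column capacities can be replaced by
an assignment along its support that respects the capacities and costs no more. -/
theorem exists_assignment_of_fractional {R C : Type*} [Fintype R] [Fintype C] [DecidableEq R]
    [DecidableEq C] (z c : R → C → ℝ) (cap : C → ℕ) (hz : ∀ r b, 0 ≤ z r b)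
    (hrow : ∀ r, ∑ b, z r b = 1) (hcol : ∀ b, ∑ r, z r b ≤ (cap b : ℝ)) :
    ∃ f : R → C, (∀ r, 0 < z r (f r)) ∧ (∀ b, (Finset.univ.filter fun r => f r = b).card ≤ cap b) ∧
      ∑ r, c r (f r) ≤ ∑ r, ∑ b, z r b * c r b := by
  classical
  have hz0 : ∀ r b, cap b = 0 → z r b = 0 := by
    intro r b hb
    have h1 := hcol b
    rw [hb, Nat.cast_zero] at h1
    have h2 := Finset.single_le_sum (f := fun r => z r b) (fun r _ => hz r b) (Finset.mem_univ r)
    exact le_antisymm (h2.trans h1) (hz r b)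
  have hcard : Fintype.card R ≤ Fintype.card (Σ b, Fin (cap b)) := by
    have : (Fintype.card R : ℝ) ≤ (Fintype.card (Σ b, Fin (cap b)) : ℝ) := by
      calc (Fintype.card R : ℝ) = ∑ r : R, ∑ b, z r b := by simp [hrow]
        _ = ∑ b, ∑ r, z r b := Finset.sum_comm
        _ ≤ ∑ b, (cap b : ℝ) := Finset.sum_le_sum fun b _ => hcol b
        _ = _ := by simp [Fintype.card_sigma]
    exact_mod_cast this
  set S := Σ b, Fin (cap b) with hS
  obtain ⟨d, hd⟩ := Nat.exists_eq_add_of_le hcard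
  have e : R ⊕ Fin d ≃ S := Fintype.equivOfCardEq (by
    rw [Fintype.card_sum, Fintype.card_fin]; exact hd.symm)
  set col : C → ℝ := fun b => ∑ r, z r b with hcoldef
  -- Column `b` is split evenly into `cap b` copies, and `d` dummy rows share the unused capacity
  -- equally, which makes the matrix doubly stochastic.
  let M : Matrix (R ⊕ Fin d) S ℝ := fun r s => match r with
    | .inl r => z r s.1 / cap s.1
    | .inr _ => (1 - col s.1 / cap s.1) / d
  have hpos : ∀ s : S, (0 : ℝ) < cap s.1 := fun s => by
    have := s.2.pos
    exact_mod_cast this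
  have hM0 : ∀ r s, 0 ≤ M r s := by
    rintro (r | r) s
    · exact div_nonneg (hz _ _) (hpos s).le
    · refine div_nonneg ?_ (Nat.cast_nonneg _)
      rw [sub_nonneg, div_le_one (hpos s)]
      exact hcol s.1
  have hspread : ∀ g : C → ℝ, (∀ b, cap b = 0 → g b = 0) →
      ∑ s : S, g s.1 / cap s.1 = ∑ b, g b := by
    intro g hg
    rw [Fintype.sum_sigma]
    refine Finset.sum_congr rfl fun b _ => ?_
    by_cases hb : cap b = 0
    · simp [hb, hg b hb]
    · have : (cap b : ℝ) ≠ 0 := by exact_mod_cast hb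
      simp
      field_simp
  have hcoltot : ∑ s : S, (1 - col s.1 / cap s.1) = d := by
    rw [Finset.sum_sub_distrib, hspread col (fun b hb => Finset.sum_eq_zero fun r _ => hz0 r b hb)]
    have h1 : ∑ b, col b = Fintype.card R := by
      rw [hcoldef, Finset.sum_comm]; simp [hrow]
    rw [h1]
    have h2 : (Fintype.card S : ℝ) = Fintype.card R + d := by exact_mod_cast hd
    simp only [Finset.sum_const, Finset.card_univ, nsmul_eq_mul, mul_one]
    rw [h2]; ring
  have hrowM : ∀ r, ∑ s, M r s = 1 := by
    rintro (r | r)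
    · exact (hspread (z r) (hz0 r)).trans (hrow r)
    · change ∑ s : S, (1 - col s.1 / cap s.1) / d = 1
      rw [← Finset.sum_div, hcoltot]
      have : (d : ℝ) ≠ 0 := by
        have := r.pos
        exact_mod_cast this.ne'
      exact div_self this
  have hcolM : ∀ s, ∑ r, M r s = 1 := by
    intro s
    rw [Fintype.sum_sum_type]
    change ∑ r, z r s.1 / cap s.1 + ∑ _r : Fin d, (1 - col s.1 / cap s.1) / d = 1
    rw [← Finset.sum_div]
    -- Without dummy rows the slacks are nonnegative with sum zero, so every column is already full.
    by_cases hd0 : d = 0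
    · subst hd0
      have hnn : ∀ s ∈ (Finset.univ : Finset S), 0 ≤ 1 - col s.1 / cap s.1 := fun s _ => by
        rw [sub_nonneg, div_le_one (hpos s)]; exact hcol s.1
      have := (Finset.sum_eq_zero_iff_of_nonneg hnn).1 (by simpa using hcoltot) s
        (Finset.mem_univ _)
      simp
      linarith
    · have : (d : ℝ) ≠ 0 := by exact_mod_cast hd0
      simp
      field_simp
      simp [hcoldef]
  let M' : Matrix S S ℝ := fun a s => M (e.symm a) s
  have hM' : M' ∈ doublyStochastic ℝ S := by
    rw [mem_doublyStochastic_iff_sum]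
    refine ⟨fun a s => hM0 _ _, fun a => hrowM _, fun s => ?_⟩
    exact (e.symm.sum_comp (fun r => M r s)).trans (hcolM s)
  obtain ⟨q, hq0, hq1, hq⟩ := exists_eq_sum_perm_of_mem_doublyStochastic hM'
  let cost : Equiv.Perm S → ℝ := fun σ => ∑ r, c r (σ (e (.inl r))).1
  have hentry : ∀ a s, M' a s = ∑ σ, if σ a = s then q σ else 0 := by
    intro a s
    rw [← hq]
    simp [Matrix.sum_apply, Equiv.Perm.permMatrix, PEquiv.toMatrix_apply, eq_comm]
  have hcost : ∑ σ, q σ * cost σ = ∑ r, ∑ b, z r b * c r b := by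
    have : ∀ r, ∑ b, z r b * c r b = ∑ s : S, M' (e (.inl r)) s * c r s.1 := by
      intro r
      rw [← hspread (fun b => z r b * c r b) (fun b hb => by simp [hz0 r b hb])]
      refine Finset.sum_congr rfl fun s _ => ?_
      simp [M', M]
      ring
    simp_rw [this, hentry, Finset.sum_mul, cost, Finset.mul_sum]
    rw [Finset.sum_comm]
    refine Finset.sum_congr rfl fun r _ => ?_
    rw [Finset.sum_comm]
    refine Finset.sum_congr rfl fun σ _ => ?_
    simp only [ite_mul, zero_mul]
    exact (Fintype.sum_ite_eq (σ (e (.inl r))) fun s : S => q σ * c r s.1).symm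
  -- The fractional cost is the `q`-average of the permutation costs, so some permutation of
  -- positive weight costs no more; positive weight also keeps it in the support.
  obtain ⟨σ, hσ, hσc⟩ : ∃ σ, 0 < q σ ∧ cost σ ≤ ∑ r, ∑ b, z r b * c r b := by
    by_contra hcon
    push Not at hcon
    have hlt : ∑ σ, q σ * (∑ r, ∑ b, z r b * c r b) < ∑ σ, q σ * cost σ := by
      refine Finset.sum_lt_sum (fun σ _ => ?_) ?_
      · rcases (hq0 σ).eq_or_lt with h | h
        · simp [← h]
        · exact mul_le_mul_of_nonneg_left (hcon σ h).le h.le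
      · obtain ⟨σ, -, h⟩ : ∃ σ ∈ Finset.univ, 0 < q σ := by
          by_contra hno
          push Not at hno
          have := Finset.sum_nonpos hno
          linarith
        exact ⟨σ, Finset.mem_univ _, mul_lt_mul_of_pos_left (hcon σ h) h⟩
    rw [← Finset.sum_mul, hq1, one_mul, hcost] at hlt
    exact lt_irrefl _ hlt
  refine ⟨fun r => (σ (e (.inl r))).1, fun r => ?_, fun b => ?_, hσc⟩
  · have h1 : 0 < M' (e (.inl r)) (σ (e (.inl r))) := by
      rw [hentry]
      refine hσ.trans_le ?_
      have := Finset.single_le_sum (s := Finset.univ)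
        (f := fun π : Equiv.Perm S => if π (e (.inl r)) = σ (e (.inl r)) then q π else 0)
        (fun π _ => by split_ifs <;> simp [hq0 π]) (Finset.mem_univ σ)
      simpa using this
    have h2 : M' (e (.inl r)) (σ (e (.inl r))) =
        z r (σ (e (.inl r))).1 / cap (σ (e (.inl r))).1 := by simp [M', M]
    rw [h2] at h1
    by_contra h
    have h3 := le_antisymm (not_lt.1 h) (hz r (σ (e (.inl r))).1)
    rw [h3] at h1
    simp at h1
  · calc (Finset.univ.filter fun r => (σ (e (.inl r))).1 = b).card
        ≤ (Finset.univ.filter fun s : S => s.1 = b).card := by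
          refine Finset.card_le_card_of_injOn (fun r => σ (e (.inl r))) ?_ ?_
          · intro r hr
            simpa using hr
          · intro r _ r' _ h
            simpa using h
      _ = cap b := by
          have : (Finset.univ.filter fun s : S => s.1 = b) =
              Finset.univ.map ⟨fun t : Fin (cap b) =>
    (⟨b, t⟩ : S), fun t t' h => by simpa using h⟩ := by
            ext ⟨b', t⟩
            simp only [Finset.mem_filter, Finset.mem_univ, true_and, Finset.mem_map]
            constructor
            · rintro rfl; exact ⟨t, rfl⟩
            · rintro ⟨t', h⟩; cases h; rfl
          rw [this]; simp

/-! ### Small copies of a single object -/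

/-- The value of a cache that loses the fraction `p / (4 * y)` of its mass. -/
theorem value_of_reduced_mass {y p t r g h D : ℝ} (hp : 0 ≤ p) (hpy : p ≤ 4 * y)
    (hg : g ≤ t * y) (hh0 : 0 ≤ h) (hh : h ≤ r * y) (hgh : g + h ≤ D * y) :
    2 * g + h - p * D / 2 ≤ (y - p / 4) * (2 * t + r) := by
  have hy : 0 ≤ y := by linarith
  rcases hy.eq_or_lt with h0 | h0
  · subst h0
    have h1 : p = 0 := by linarith
    subst h1
    nlinarith
  · set e := p / (4 * y) with he
    have hpe : p = 4 * y * e := by rw [he]; field_simp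
    -- On the kept proportion `1 - e` the separate bounds for `g` and `h` apply; on the lost
    -- proportion `e` only `2 * g + h ≤ 2 * D * y` is used.
    have he0 : 0 ≤ e := by positivity
    have he1 : e ≤ 1 := by rw [he]; exact div_le_one_of_le₀ hpy (by positivity)
    rw [hpe]
    have h1 : 0 ≤ (1 - e) * (y * (2 * t + r) - (2 * g + h)) :=
      mul_nonneg (by linarith) (by linarith)
    have h2 : 0 ≤ e * (2 * (D * y) - (2 * g + h)) := mul_nonneg he0 (by linarith)
    nlinarith

/-- Greedy choice of `N` units of small mass together with a splitting into slots.  Every choice of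
one cache per slot has at least the value of the small fractional mass, less a quarter unit. -/
theorem exists_slots_value {ι : Type*} [Fintype ι] [DecidableEq ι] (w y : ι → ℝ) (N : ℕ)
    (hw : ∀ i, 0 ≤ w i) (hy : ∀ i, 0 ≤ y i) (hy2 : ∀ i, y i ≤ 1 / 2) (hN : ∑ i, y i ≤ N)
    (hN2 : (N : ℝ) ≤ 2 * ∑ i, y i) :
    ∃ (Z : Fin N → ι → ℝ) (p : ι → ℝ), (∀ t i, 0 ≤ Z t i) ∧ (∀ t, ∑ i, Z t i = 1) ∧
      (∀ i, ∑ t, Z t i ≤ 1) ∧ (∀ i, ∑ t, Z t i ≤ 4 * y i) ∧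
      (∀ i, 0 ≤ p i) ∧ (∀ i, p i ≤ 4 * y i) ∧ ∑ i, p i ≤ 1 ∧
      ∀ f : Fin N → ι, (∀ t, 0 < Z t (f t)) →
        ∑ i, (y i - p i / 4) * w i ≤ ∑ t, w (f t) := by
  -- There is room for mass `N`, because `y i ≤ 1/2` gives `2 * y i ≤ min 1 (4 * y i)`.
  obtain ⟨z, z0, z1, zN, zg⟩ := exists_greedy_subvector w (fun i => min 1 (4 * y i))
    (fun i => le_min zero_le_one (by linarith [hy i])) N (Nat.cast_nonneg N) (by
      refine hN2.trans ?_
      rw [Finset.mul_sum]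
      refine Finset.sum_le_sum fun i _ => le_min ?_ ?_ <;> linarith [hy i, hy2 i])
  -- `l` is the greedy threshold: used indices weigh at least `l`, and heavier ones are saturated.
  have hl : ∃ l : ℝ, 0 ≤ l ∧ (∀ i, 0 < z i → l ≤ w i) ∧
      (∀ i, l < w i → z i = min 1 (4 * y i)) := by
    by_cases hne : (Finset.univ.filter fun i => 0 < z i).Nonempty
    · obtain ⟨a, ha, hmin⟩ := Finset.exists_min_image _ w hne
      simp only [Finset.mem_filter, Finset.mem_univ, true_and] at ha hmin
      refine ⟨w a, hw a, hmin, fun i hi => ?_⟩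
      by_contra hcon
      exact absurd (zg a i ha (lt_of_le_of_ne (z1 i) hcon)) (not_le.2 hi)
    · have hz0 : ∀ i, z i = 0 := fun i => by
        by_contra hcon
        exact hne ⟨i, by simpa using lt_of_le_of_ne (z0 i) (Ne.symm hcon)⟩
      have hNz : (N : ℝ) = 0 := by rw [← zN]; simp [hz0]
      have hyz : ∀ i, y i = 0 := fun i =>
        (Finset.sum_eq_zero_iff_of_nonneg fun i _ => hy i).1
          (le_antisymm (hN.trans hNz.le) (Finset.sum_nonneg fun i _ => hy i)) i (Finset.mem_univ _)
      refine ⟨0, le_rfl, fun i hi => hw i, fun i _ => ?_⟩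
      rw [hz0, hyz]; simp
  obtain ⟨l, l0, l1, l2⟩ := hl
  obtain ⟨Z, p, h0, h1, h2, h3, h4, h5, h6, h7⟩ := exists_slots w l N z z0
    (fun i => (z1 i).trans (min_le_left _ _)) zN l1
  refine ⟨Z, p, h0, h1, fun i => ?_, fun i => ?_, h3, fun i => ?_, h5, fun f hf => ?_⟩
  · rw [h2]; exact (z1 i).trans (min_le_left _ _)
  · rw [h2]; exact (z1 i).trans (min_le_right _ _)
  · exact (h4 i).trans ((z1 i).trans (min_le_right _ _))
  refine le_trans ?_ (h7 f hf)
  -- the comparison vector `p + y - p / 4`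
  have key : ∀ i, 0 ≤ (z i - (p i + y i - p i / 4)) * (w i - l) := by
    intro i
    rcases lt_trichotomy (w i) l with hlt | heq | hgt
    · have hz : z i = 0 := by
        by_contra hcon
        exact absurd (l1 i (lt_of_le_of_ne (z0 i) (Ne.symm hcon))) (not_le.2 hlt)
      have := h3 i
      have := hy i
      nlinarith
    · rw [heq, sub_self, mul_zero]
    -- Above the threshold `z` is saturated. If `z i = 1`, then `p i = 0` and `y i ≤ 1/2`. Otherwise
    -- `p i ≤ z i = 4 * y i`, and `y i + 3 / 4 * p i ≤ 4 * y i`, with the factor 4 exactly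
    -- sufficient.
    · refine mul_nonneg ?_ (by linarith)
      have hz := l2 i hgt
      by_cases hfull : z i = 1
      · rw [h6 i hfull, hfull]
        linarith [hy2 i]
      · have h4y : z i = 4 * y i := by
          rcases min_choice 1 (4 * y i) with h | h
          · exact absurd (hz.trans h) hfull
          · exact hz.trans h
        have := h4 i
        linarith
  have hsum := Finset.sum_nonneg fun i (_ : i ∈ Finset.univ) => key i
  have hexp : ∑ i, (z i - (p i + y i - p i / 4)) * (w i - l) =
      ∑ i, z i * w i - ∑ i, p i * w i - ∑ i, (y i - p i / 4) * w i
        - l * (N - ∑ i, y i - 3 / 4 * ∑ i, p i) := by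
    rw [← zN]
    simp only [Finset.mul_sum, ← Finset.sum_sub_distrib]
    refine Finset.sum_congr rfl fun i _ => by ring
  rw [hexp] at hsum
  -- Together with the term `l * ∑ p` from the slots, the constants amount to `l * (N - ∑ y + ∑ p /
  -- 4)`, which is nonnegative.
  have hp0 : 0 ≤ ∑ i, p i := Finset.sum_nonneg fun i _ => h3 i
  have : 0 ≤ l * (N - ∑ i, y i) := mul_nonneg l0 (by linarith)
  have : 0 ≤ l * ∑ i, p i := mul_nonneg l0 hp0
  nlinarith

/-- Number of copies of an object that are placed in the caches holding less than half of it. -/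
noncomputable def smallCopies {ι : Type*} [Fintype ι] (y : ι → ℝ) : ℕ :=
  if 1 / 2 ≤ ∑ i with y i < 1 / 2, y i then ⌈∑ i with y i < 1 / 2, y i⌉₊ else 0

/-- Slots for the small copies of one object.  However the slots are filled along their support
with distinct caches, the demand of the small caches without a copy is bounded by the capacity of
the copies and of the large caches and by the load of the server. -/
theorem exists_object_slots {ι : Type*} [Fintype ι] [DecidableEq ι] (τ r y : ι → ℝ)
    (x : Option ι → ι → ℝ) (hτ : ∀ i, 0 ≤ τ i) (hr : ∀ j, 0 ≤ r j) (hx : ∀ i j, 0 ≤ x i j)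
    (hy : ∀ i, 0 ≤ y i) (hcopy : ∀ i, ∑ j with j ≠ i, x (some i) j ≤ τ i * y i)
    (hserved : ∀ j, ∑ i, x i j = r j) (hstored : ∀ i j, x (some i) j ≤ r j * y i) :
    ∃ Z : Fin (smallCopies y) → ι → ℝ, (∀ t i, 0 ≤ Z t i) ∧ (∀ t, ∑ i, Z t i = 1) ∧
      (∀ i, ∑ t, Z t i ≤ 1) ∧ (∀ i, ∑ t, Z t i ≤ 4 * y i) ∧
      (∀ t i, 0 < Z t i → y i < 1 / 2) ∧
      ∀ f : Fin (smallCopies y) → ι, Function.Injective f → (∀ t, 0 < Z t (f t)) →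
        ∑ j with y j < 1 / 2 ∧ ∀ t, f t ≠ j, r j ≤
          2 * ∑ t, τ (f t) + 2 * ∑ i with ¬ y i < 1 / 2, τ i * y i + 2 * ∑ j, x none j := by
  classical
  set S : Finset ι := Finset.univ.filter fun i => y i < 1 / 2 with hS
  set B : Finset ι := Finset.univ.filter fun i => ¬ y i < 1 / 2 with hB
  have memS : ∀ i, i ∈ S ↔ y i < 1 / 2 := fun i => by simp [hS]
  set D : ℝ := ∑ j ∈ S, r j with hD
  have hD0 : 0 ≤ D := Finset.sum_nonneg fun j _ => hr j
  set small : ℝ := ∑ i ∈ S, ∑ j ∈ S, x (some i) j with hsmall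
  have hserver : ∑ j ∈ S, x none j ≤ ∑ j, x none j :=
    Finset.sum_le_univ_sum_of_nonneg fun j => hx none j
  have hbig : ∑ i ∈ B, ∑ j ∈ S, x (some i) j ≤ ∑ i ∈ B, τ i * y i := by
    refine Finset.sum_le_sum fun i hi => le_trans ?_ (hcopy i)
    refine Finset.sum_le_sum_of_subset_of_nonneg ?_ fun j _ _ => hx _ _
    intro j hj
    have h1 := (memS j).1 hj
    have h2 : ¬ y i < 1 / 2 := by simpa [hB] using hi
    simp only [Finset.mem_filter, Finset.mem_univ, true_and]
    rintro rfl
    exact h2 h1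
  have hDsplit : D = ∑ j ∈ S, x none j + (small + ∑ i ∈ B, ∑ j ∈ S, x (some i) j) := by
    rw [hD, hsmall, hS, hB, Finset.sum_filter_add_sum_filter_not Finset.univ
      (fun i => y i < 1 / 2) (fun i => ∑ j ∈ S, x (some i) j), Finset.sum_comm,
      ← Finset.sum_add_distrib]
    refine Finset.sum_congr rfl fun j _ => ?_
    rw [← hserved j, Fintype.sum_option]
  by_cases hn : 1 / 2 ≤ ∑ i ∈ S, y i
  · have hNdef : smallCopies y = ⌈∑ i ∈ S, y i⌉₊ := by rw [smallCopies]; exact if_pos hn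
    set ys : ι → ℝ := fun i => if y i < 1 / 2 then y i else 0 with hys
    have hyssum : ∑ i, ys i = ∑ i ∈ S, y i := by rw [hys, hS, Finset.sum_filter]
    have hN1 : ∑ i, ys i ≤ (smallCopies y : ℝ) := by rw [hyssum, hNdef]; exact Nat.le_ceil _
    have hN2 : (smallCopies y : ℝ) ≤ 2 * ∑ i, ys i := by
      rw [hyssum, hNdef]
      rcases le_or_gt (∑ i ∈ S, y i) 1 with h | h
      · have : ⌈∑ i ∈ S, y i⌉₊ ≤ 1 := Nat.ceil_le.2 (by simpa using h)
        have : (⌈∑ i ∈ S, y i⌉₊ : ℝ) ≤ 1 := by exact_mod_cast this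
        linarith
      · have := Nat.ceil_lt_add_one (show 0 ≤ ∑ i ∈ S, y i by linarith)
        linarith
    have hys0 : ∀ i, 0 ≤ ys i := fun i => by
      simp only [hys]; split_ifs
      · exact hy i
      · exact le_rfl
    have hysy : ∀ i, ys i ≤ y i := fun i => by
      simp only [hys]; split_ifs
      · exact le_rfl
      · exact hy i
    have hys2 : ∀ i, ys i ≤ 1 / 2 := fun i => by
      simp only [hys]; split_ifs with h
      · exact h.le
      · norm_num
    obtain ⟨Z, p, h0, h1, h2, h3, p0, p1, p2, hval⟩ := exists_slots_value
      (fun i => 2 * τ i + r i) ys (smallCopies y) (fun i => by linarith [hτ i, hr i]) hys0 hys2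
      hN1 hN2
    have hsupp : ∀ t i, 0 < Z t i → y i < 1 / 2 := by
      intro t i ht
      by_contra hcon
      have ha := Finset.single_le_sum (f := fun t => Z t i) (fun t _ => h0 t i) (Finset.mem_univ t)
      have hb := h3 i
      simp only [hys, hcon, if_false] at hb
      linarith
    refine ⟨Z, h0, h1, h2, fun i => (h3 i).trans (by linarith [hysy i]), hsupp, ?_⟩
    intro f hinj hf
    have hv := hval f hf
    -- Here `g` is what `i` uploads to other small caches and `h` is what it serves to itself, so `2
    -- * g + h` is twice the total minus the local part.
    have hper : ∀ i, (if y i < 1 / 2 then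
        2 * (∑ j ∈ S, x (some i) j) - x (some i) i else 0) - p i * D / 2 ≤
        (ys i - p i / 4) * (2 * τ i + r i) := by
      intro i
      by_cases hi : y i < 1 / 2
      · have hiS := (memS i).2 hi
        have hysi : ys i = y i := if_pos hi
        rw [if_pos hi]
        have hsplit := Finset.add_sum_erase S (fun j => x (some i) j) hiS
        have hg : ∑ j ∈ S.erase i, x (some i) j ≤ τ i * y i := by
          refine le_trans (Finset.sum_le_sum_of_subset_of_nonneg ?_ fun j _ _ => hx _ _) (hcopy i)
          intro j hj
          simpa using Finset.ne_of_mem_erase hj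
        have hgh : ∑ j ∈ S, x (some i) j ≤ D * y i := by
          rw [hD, Finset.sum_mul]
          exact Finset.sum_le_sum fun j _ => hstored i j
        have := value_of_reduced_mass (t := τ i) (r := r i) (D := D) (p0 i)
          (by rw [← hysi]; exact p1 i) hg (hx _ _) (hstored i i)
          (by linarith)
        rw [hysi]
        linarith
      · have hysi : ys i = 0 := if_neg hi
        have hpi : p i = 0 := le_antisymm (by simpa [hysi] using p1 i) (p0 i)
        rw [if_neg hi, hysi, hpi]
        simp
    have hsum := Finset.sum_le_sum fun i (_ : i ∈ Finset.univ) => hper i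
    rw [Finset.sum_sub_distrib, ← Finset.sum_filter, Finset.sum_sub_distrib, ← Finset.mul_sum,
      ← Finset.sum_div, ← Finset.sum_mul] at hsum
    -- Local service costs at most `D / 2`, since `y i < 1/2`, and the lost slot at most another `D
    -- / 2`. So the chosen caches are worth at least `2 * small - D`, and `hDsplit` replaces
    -- `small`.
    have hself : ∑ i ∈ S, x (some i) i ≤ D / 2 := by
      rw [hD, Finset.sum_div]
      refine Finset.sum_le_sum fun i hi => (hstored i i).trans ?_
      have := mul_le_mul_of_nonneg_left ((memS i).1 hi).le (hr i)
      linarith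
    have hpD : (∑ i, p i) * D ≤ 1 * D := mul_le_mul_of_nonneg_right p2 hD0
    have hlocal : ∑ j with y j < 1 / 2 ∧ ∀ t, f t ≠ j, r j = D - ∑ t, r (f t) := by
      have himg : ∑ t, r (f t) = ∑ j with y j < 1 / 2 ∧ ¬ ∀ t, f t ≠ j, r j := by
        rw [← Finset.sum_image (s := Finset.univ) (g := f) (f := r) (fun a _ b _ h => hinj h)]
        refine Finset.sum_congr ?_ fun _ _ => rfl
        ext j
        simp only [Finset.mem_image, Finset.mem_univ, true_and, Finset.mem_filter, not_forall,
          not_not]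
        constructor
        · rintro ⟨t, rfl⟩
          exact ⟨hsupp t _ (hf t), t, rfl⟩
        · rintro ⟨-, h⟩; exact h
      rw [himg, hD, hS, ← Finset.filter_filter, ← Finset.filter_filter,
        ← Finset.sum_filter_add_sum_filter_not (Finset.univ.filter fun i => y i < 1 / 2)
          (fun j => ∀ t, f t ≠ j) r]
      ring
    rw [Finset.sum_add_distrib, ← Finset.mul_sum] at hv
    rw [hlocal]
    change 2 * small - _ - _ ≤ _ at hsum
    linarith
  · have hN0 : smallCopies y = 0 := by rw [smallCopies]; exact if_neg hn
    have : IsEmpty (Fin (smallCopies y)) := by rw [hN0]; infer_instance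
    refine ⟨fun _ _ => 0, fun _ _ => le_rfl, fun t => this.elim t, by simp,
      fun i => by simpa using hy i, fun t => this.elim t, ?_⟩
    intro f _ _
    simp only [IsEmpty.forall_iff, and_true, Finset.univ_eq_empty, Finset.sum_empty]
    change D ≤ _
    -- With mass below 1/2 the small caches serve at most half of `D`; the server and the large
    -- caches serve the rest.
    have hle : small ≤ D * ∑ i ∈ S, y i := by
      rw [hsmall, hD, Finset.mul_sum]
      refine Finset.sum_le_sum fun i _ => ?_
      rw [Finset.sum_mul]
      exact Finset.sum_le_sum fun j _ => hstored i j
    have := mul_le_mul_of_nonneg_left (not_le.1 hn).le hD0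
    linarith

/-! ### Integral routing -/

/-- Integral routing by Hall's theorem: caches containing an object serve their own requests for
it, and the remaining requests are served by capacities that suffice for every single object. -/
theorem exists_routing {ι κ : Type*} [Fintype ι] [Fintype κ] [DecidableEq ι] [DecidableEq κ]
    (F : ι → Finset κ) (r : ι → κ → ℕ) (U : ι → ℕ) (cap : ι → κ → ℝ) (σ : κ → ℝ)
    (hcap : ∀ i k, 0 ≤ cap i k) (hσ : ∀ k, 0 ≤ σ k) (hcapF : ∀ i k, k ∉ F i → cap i k = 0)
    (hU : ∀ i, ∑ k, cap i k ≤ (U i : ℝ))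
    (hdem : ∀ k, ∑ j with k ∉ F j, (r j k : ℝ) ≤ ∑ i, cap i k + σ k) :
    ∃ x : Option ι → ι → κ → ℕ, (∀ j k, ∑ i, x i j k = r j k) ∧
      (∀ i j k, x (some i) j k ≠ 0 → k ∈ F i) ∧
      (∀ i, CacheInstance.uploaded x i ≤ U i) ∧
      (CacheInstance.serverLoad x : ℝ) ≤ ∑ k, σ k := by
  classical
  let rem : ι → κ → ℕ := fun j k => if k ∈ F j then 0 else r j k
  let Request := Σ jk : ι × κ, Fin (rem jk.1 jk.2)
  let d := ⌊∑ k, σ k⌋₊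
  let T := (Σ i, Fin (U i)) ⊕ Fin d
  let rel : Request → T → Prop := fun u b => match b with
    | .inl s => u.1.2 ∈ F s.1
    | .inr _ => True
  have hσtot : 0 ≤ ∑ k, σ k := Finset.sum_nonneg fun k _ => hσ k
  have hunits : ∀ k, (Finset.univ.filter fun u : Request => u.1.2 = k).card = ∑ j, rem j k := by
    intro k
    rw [Finset.card_filter, Fintype.sum_sigma, Fintype.sum_prod_type]
    refine Finset.sum_congr rfl fun j _ => ?_
    rw [Finset.sum_eq_single k (fun k' _ h => by simp [h]) (by simp)]
    simp
  have hall : ∀ A : Finset Request, A.card ≤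
    (Finset.univ.filter fun b => ∃ a ∈ A, rel a b).card := by
    intro A
    rcases A.eq_empty_or_nonempty with rfl | ⟨a₀, ha₀⟩
    · simp
    set K : Finset κ := A.image fun u => u.1.2 with hK
    set J : Finset ι := Finset.univ.filter fun i => ∃ k ∈ K, k ∈ F i with hJ
    -- Only the set `K` of requested objects matters in Hall's condition: the per-object bounds add
    -- up over `K`, and all their capacity lies in caches of `J`.
    have h1 : (A.card : ℝ) ≤ ∑ k ∈ K, (∑ i, cap i k + σ k) := by
      have h : A.card ≤ ∑ k ∈ K, ∑ j, rem j k := by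
        rw [Finset.card_eq_sum_card_fiberwise (f := fun u : Request => u.1.2) (t := K)
          (fun u hu => Finset.mem_image_of_mem _ hu)]
        refine Finset.sum_le_sum fun k _ => ?_
        rw [← hunits k]
        exact Finset.card_le_card (Finset.filter_subset_filter _ (Finset.subset_univ _))
      calc (A.card : ℝ) ≤ ((∑ k ∈ K, ∑ j, rem j k : ℕ) : ℝ) := by exact_mod_cast h
        _ = ∑ k ∈ K, ∑ j with k ∉ F j, (r j k : ℝ) := by
          push_cast
          refine Finset.sum_congr rfl fun k _ => ?_
          rw [Finset.sum_filter]
          refine Finset.sum_congr rfl fun j _ => ?_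
          by_cases h : k ∈ F j <;> simp [rem, h]
        _ ≤ _ := Finset.sum_le_sum fun k _ => hdem k
    have h2 : ∑ k ∈ K, ∑ i, cap i k ≤ ∑ i ∈ J, (U i : ℝ) := by
      rw [Finset.sum_comm, ← Finset.sum_subset (Finset.subset_univ J)]
      · refine Finset.sum_le_sum fun i _ => le_trans ?_ (hU i)
        exact Finset.sum_le_univ_sum_of_nonneg fun k => hcap i k
      · intro i _ hi
        refine Finset.sum_eq_zero fun k hk => hcapF i k fun hkF => hi ?_
        rw [hJ, Finset.mem_filter]
        exact ⟨Finset.mem_univ _, k, hk, hkF⟩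
    have h3 : ∑ k ∈ K, σ k ≤ ∑ k, σ k := Finset.sum_le_univ_sum_of_nonneg hσ
    -- The server allowances of all objects are pooled; the cardinalities are integers, so rounding
    -- the pool down to `d` loses nothing.
    have h4 : A.card ≤ ∑ i ∈ J, U i + d := by
      rw [Finset.sum_add_distrib] at h1
      have h5 : (A.card : ℝ) - ((∑ i ∈ J, U i : ℕ) : ℝ) ≤ ∑ k, σ k := by push_cast; linarith
      by_contra hcon
      push Not at hcon
      have h6 : ((A.card - ∑ i ∈ J, U i : ℕ) : ℝ) ≤ ∑ k, σ k := by
        rw [Nat.cast_sub (by omega)]; exact h5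
      have h7 := Nat.le_floor h6
      change _ ≤ d at h7
      omega
    refine h4.trans ?_
    have hcard : ((J.sigma fun i => (Finset.univ : Finset (Fin (U i)))).disjSum
        (Finset.univ : Finset (Fin d))).card = ∑ i ∈ J, U i + d := by
      simp [Finset.card_disjSum, Finset.card_sigma]
    rw [← hcard]
    refine Finset.card_le_card fun b hb => ?_
    rw [Finset.mem_filter]
    refine ⟨Finset.mem_univ _, ?_⟩
    rcases b with s | t
    · simp only [Finset.inl_mem_disjSum, Finset.mem_sigma, Finset.mem_univ, and_true, hJ, hK,
        Finset.mem_filter, true_and, Finset.mem_image] at hb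
      obtain ⟨k, ⟨a, ha, rfl⟩, hk⟩ := hb
      exact ⟨a, ha, hk⟩
    · exact ⟨a₀, ha₀, trivial⟩
  obtain ⟨f, hf, hfrel⟩ := (Fintype.all_card_le_filter_rel_iff_exists_injective rel).1 hall
  let provider : T → Option ι := Sum.elim (fun s => some s.1) (fun _ => none)
  have hload : ∀ o : Option ι, ∑ j, ∑ k, ∑ v : Fin (rem j k),
      (if provider (f ⟨(j, k), v⟩) = o then 1 else 0) ≤
        (Finset.univ.filter fun b : T => provider b = o).card := by
    intro o
    have : ∑ j, ∑ k, ∑ v : Fin (rem j k), (if provider (f ⟨(j, k), v⟩) = o then 1 else 0) =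
        (Finset.univ.filter fun u : Request => provider (f u) = o).card := by
      rw [Finset.card_filter, Fintype.sum_sigma, Fintype.sum_prod_type]
    rw [this]
    refine Finset.card_le_card_of_injOn f ?_ hf.injOn
    intro u hu
    simpa using hu
  have hprovSome : ∀ i, (Finset.univ.filter fun b : T => provider b = some i).card = U i := by
    intro i
    rw [Finset.card_filter, Fintype.sum_sum_type, Fintype.sum_sigma]
    simp [provider]
  have hprovNone : (Finset.univ.filter fun b : T => provider b = none).card = d := by
    rw [Finset.card_filter, Fintype.sum_sum_type, Fintype.sum_sigma]
    simp [provider]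
  refine ⟨fun o j k => (if o = some j then (if k ∈ F j then r j k else 0) else 0) +
    ∑ v : Fin (rem j k), (if provider (f ⟨(j, k), v⟩) = o then 1 else 0), ?_, ?_, ?_, ?_⟩
  · intro j k
    rw [Finset.sum_add_distrib, Finset.sum_comm]
    simp only [Finset.sum_ite_eq, Finset.sum_ite_eq', Finset.mem_univ, if_true, Finset.sum_const,
      Finset.card_univ, Fintype.card_fin, smul_eq_mul, mul_one]
    by_cases h : k ∈ F j <;> simp [rem, h]
  · intro i j k hne
    by_contra hk
    apply hne
    have h1 : ∀ v : Fin (rem j k), provider (f ⟨(j, k), v⟩) ≠ some i := by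
      intro v hv
      have hr := hfrel ⟨(j, k), v⟩
      rcases hfv : f ⟨(j, k), v⟩ with s | t
      · rw [hfv] at hr hv
        have : s.1 = i := by simpa [provider] using hv
        exact hk (this ▸ hr)
      · rw [hfv] at hv
        simp [provider] at hv
    have h2 : (if some i = some j then (if k ∈ F j then r j k else 0) else 0) = 0 := by
      split_ifs with ha hb
      · rw [Option.some.inj ha] at hk; exact absurd hb hk
      · rfl
      · rfl
    exact Nat.add_eq_zero_iff.2 ⟨h2, Finset.sum_eq_zero fun v _ => if_neg (h1 v)⟩
  · intro i
    refine le_trans ?_ ((hload (some i)).trans (hprovSome i).le)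
    refine le_trans ?_ (Finset.sum_le_sum_of_subset (Finset.subset_univ
      (Finset.univ.filter fun j => j ≠ i)))
    refine Finset.sum_le_sum fun j hj => Finset.sum_le_sum fun k _ => ?_
    have hji : some i ≠ some j := fun h => (Finset.mem_filter.1 hj).2 (Option.some.inj h).symm
    simp [hji]
  · have h := (hload none).trans hprovNone.le
    refine le_trans ?_ (Nat.floor_le hσtot)
    have h' : CacheInstance.serverLoad (fun o j k =>
        (if o = some j then (if k ∈ F j then r j k else 0) else 0) +
        ∑ v : Fin (rem j k), (if provider (f ⟨(j, k), v⟩) = o then 1 else 0)) ≤ d := by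
      refine le_trans (le_of_eq ?_) h
      simp [CacheInstance.serverLoad]
    exact_mod_cast h'

/-! ### Placing all objects simultaneously -/

/-- The slots of all objects can be filled along their support, with distinct caches for the slots
of one object, such that every cache receives at most its fractional number of objects, rounded
up, and the cost does not exceed the fractional one. -/
theorem exists_placement {ι κ : Type*} [Fintype ι] [Fintype κ] [DecidableEq ι] [DecidableEq κ]
    (n : κ → ℕ) (Z : ∀ k, Fin (n k) → ι → ℝ) (hZ : ∀ k t i, 0 ≤ Z k t i)
    (hrow : ∀ k t, ∑ i, Z k t i = 1) (hcol : ∀ k i, ∑ t, Z k t i ≤ 1) (c : ι → κ → ℝ)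
    (hc : ∀ i k, 0 ≤ c i k) :
    ∃ g : ∀ k, Fin (n k) → ι, (∀ k, Function.Injective (g k)) ∧ (∀ k t, 0 < Z k t (g k t)) ∧
      (∀ i, (Finset.univ.filter fun k => ∃ t, g k t = i).card ≤ ⌈∑ k, ∑ t, Z k t i⌉₊) ∧
      ∑ i, ∑ k with ∃ t, g k t = i, c i k ≤ ∑ i, ∑ k, (∑ t, Z k t i) * c i k := by
  classical
  let m : κ → ι → ℝ := fun k i => ∑ t, Z k t i
  have hm : ∀ k i, 0 ≤ m k i := fun k i => Finset.sum_nonneg fun t _ => hZ k t i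
  -- A two-stage flow written as one assignment problem. Each pair `(k, i)` is both a row and a
  -- column of capacity one. A slot taking the column displaces the row to the column of cache `i`,
  -- where the budget of `i` and the cost are charged.
  let z : (Σ k, Fin (n k)) ⊕ (κ × ι) → (κ × ι) ⊕ ι → ℝ := fun r b => match r, b with
    | .inl s, .inl q => if q.1 = s.1 then Z s.1 s.2 q.2 else 0
    | .inl _, .inr _ => 0
    | .inr q, .inl q' => if q' = q then 1 - m q.1 q.2 else 0
    | .inr q, .inr i => if i = q.2 then m q.1 q.2 else 0
  let cost : (Σ k, Fin (n k)) ⊕ (κ × ι) → (κ × ι) ⊕ ι → ℝ := fun r b => match r, b with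
    | .inr q, .inr _ => c q.2 q.1
    | _, _ => 0
  let cap : (κ × ι) ⊕ ι → ℕ := Sum.elim (fun _ => 1) (fun i => ⌈∑ k, ∑ t, Z k t i⌉₊)
  obtain ⟨f, hf, hfcap, hfcost⟩ := exists_assignment_of_fractional z cost cap
    (by
      rintro (s | q) (q' | i)
      · change 0 ≤ if q'.1 = s.1 then Z s.1 s.2 q'.2 else 0
        split_ifs
        · exact hZ _ _ _
        · exact le_rfl
      · exact le_rfl
      · change 0 ≤ if q' = q then 1 - m q.1 q.2 else 0
        split_ifs
        · exact sub_nonneg.2 (hcol _ _)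
        · exact le_rfl
      · change 0 ≤ if i = q.2 then m q.1 q.2 else 0
        split_ifs
        · exact hm _ _
        · exact le_rfl)
    (by
      rintro (s | q)
      · rw [Fintype.sum_sum_type]
        change ∑ q : κ × ι, (if q.1 = s.1 then Z s.1 s.2 q.2 else 0) + ∑ _i : ι, (0 : ℝ) = 1
        rw [Fintype.sum_prod_type_right]
        simp [hrow]
      · rw [Fintype.sum_sum_type]
        change ∑ q' : κ × ι, (if q' = q then 1 - m q.1 q.2 else 0) +
          ∑ i : ι, (if i = q.2 then m q.1 q.2 else 0) = 1
        simp)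
    (by
      rintro (q | i)
      · rw [Fintype.sum_sum_type]
        change ∑ s : (Σ k, Fin (n k)), (if q.1 = s.1 then Z s.1 s.2 q.2 else 0) +
          ∑ q' : κ × ι, (if q = q' then 1 - m q'.1 q'.2 else 0) ≤ ((1 : ℕ) : ℝ)
        rw [Fintype.sum_sigma, Finset.sum_eq_single q.1 (fun k _ h => by simp [h.symm]) (by simp)]
        simp [m]
      · rw [Fintype.sum_sum_type]
        change ∑ s : (Σ k, Fin (n k)), (0 : ℝ) + ∑ q : κ × ι, (if i = q.2 then m q.1 q.2 else 0) ≤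
          ((⌈∑ k, ∑ t, Z k t i⌉₊ : ℕ) : ℝ)
        rw [Fintype.sum_prod_type]
        simpa [m] using Nat.le_ceil (∑ k, ∑ t, Z k t i))
  have hslot : ∀ k t, ∃ i, f (.inl ⟨k, t⟩) = .inl (k, i) ∧ 0 < Z k t i := by
    intro k t
    have h := hf (.inl ⟨k, t⟩)
    rcases hq : f (.inl ⟨k, t⟩) with q | i
    · rw [hq] at h
      change 0 < if q.1 = k then Z k t q.2 else 0 at h
      split_ifs at h with hk
      · exact ⟨q.2, by rw [← hk], h⟩
      · exact absurd h (lt_irrefl _)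
    · rw [hq] at h
      exact absurd h (lt_irrefl _)
  choose g hg hgpos using hslot
  have huniq : ∀ r r' q, f r = .inl q → f r' = .inl q → r = r' := by
    intro r r' q h h'
    have := Finset.card_le_one.1 (hfcap (.inl q)) r (by simpa using h) r' (by simpa using h')
    exact this
  -- The row `(k, i)` is supported on its own column and on `i`; once a slot occupies the former,
  -- only `i` remains.
  have hmid : ∀ k i, (∃ t, g k t = i) → f (.inr (k, i)) = .inr i := by
    rintro k i ⟨t, rfl⟩
    have h := hf (.inr (k, g k t))
    rcases hq : f (.inr (k, g k t)) with q | i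
    · rw [hq] at h
      change 0 < if q = (k, g k t) then _ else (0 : ℝ) at h
      split_ifs at h with hk
      · subst hk
        exact absurd (huniq _ _ _ hq (hg k t)) (by simp)
      · exact absurd h (lt_irrefl _)
    · rw [hq] at h
      change 0 < if i = g k t then _ else (0 : ℝ) at h
      split_ifs at h with hk
      · rw [hk]
      · exact absurd h (lt_irrefl _)
  refine ⟨g, fun k t t' h => ?_, hgpos, fun i => ?_, ?_⟩
  · have := huniq _ _ _ (hg k t) (by rw [h]; exact hg k t')
    simpa using this
  · refine le_trans ?_ (hfcap (.inr i))
    refine Finset.card_le_card_of_injOn (fun k => .inr (k, i)) ?_ ?_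
    · intro k hk
      simpa using hmid k i (by simpa using hk)
    · intro k _ k' _ h
      simpa using h
  · calc ∑ i, ∑ k with ∃ t, g k t = i, c i k
        ≤ ∑ i, ∑ k, cost (.inr (k, i)) (f (.inr (k, i))) := by
          refine Finset.sum_le_sum fun i _ => ?_
          rw [Finset.sum_filter]
          refine Finset.sum_le_sum fun k _ => ?_
          split_ifs with h
          · rw [hmid k i h]
          · rcases f (.inr (k, i)) with q | i'
            · exact le_rfl
            · exact hc _ _
      _ = ∑ r, cost r (f r) := by
          rw [Fintype.sum_sum_type, Fintype.sum_prod_type_right]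
          have : ∑ s, cost (.inl s) (f (.inl s)) = 0 := Finset.sum_eq_zero fun s _ => rfl
          rw [this, zero_add]
      _ ≤ _ := hfcost
      _ = ∑ i, ∑ k, (∑ t, Z k t i) * c i k := by
          rw [Fintype.sum_sum_type, Fintype.sum_prod_type_right]
          have h1 : ∑ s, ∑ b, z (.inl s) b * cost (.inl s) b = 0 :=
            Finset.sum_eq_zero fun s _ => Finset.sum_eq_zero fun b _ => mul_zero _
          rw [h1, zero_add]
          refine Finset.sum_congr rfl fun i _ => Finset.sum_congr rfl fun k _ => ?_
          rw [Fintype.sum_sum_type]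
          change ∑ q : κ × ι, z (.inr (k, i)) (.inl q) * 0 +
            ∑ i' : ι, (if i' = i then m k i else 0) * c i k = _
          simp [m]

/-! ### Local service of the most demanded objects -/

namespace CacheInstance

variable {ι κ : Type*}

theorem tau_nonneg (I : CacheInstance ι κ) (i : ι) : 0 ≤ I.tau i :=
  div_nonneg (Nat.cast_nonneg _) (Nat.cast_nonneg _)

theorem tauMax_nonneg (I : CacheInstance ι κ) : 0 ≤ I.tauMax :=
  Real.iSup_nonneg fun i => I.tau_nonneg i

/-- Equality fails for empty storage, where `tau` is zero by the convention on division. -/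
theorem tau_mul_storage_le (I : CacheInstance ι κ) (i : ι) :
    I.tau i * (I.storage i : ℝ) ≤ I.upload i := by
  unfold tau
  by_cases h : (I.storage i : ℝ) = 0
  · simp [h]
  · rw [div_mul_cancel₀ _ h]

/-- The fractional locally served requests of a cache do not exceed its demand for the objects of
largest demand that fit in its storage. -/
theorem sum_local_le_sum_top [Fintype κ] [DecidableEq κ] (r x y : κ → ℝ) (O : Finset κ) (s : ℝ)
    (hr : ∀ k, 0 ≤ r k)
    (hxr : ∀ k, x k ≤ r k) (hxy : ∀ k, x k ≤ r k * y k) (hy : ∀ k, 0 ≤ y k) (hs : ∑ k, y k ≤ s)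
    (hO : O = Finset.univ ∨ s ≤ O.card) (htop : ∀ k ∈ O, ∀ k' ∉ O, r k' ≤ r k) :
    ∑ k, x k ≤ ∑ k ∈ O, r k := by
  rcases hO with rfl | hO
  · exact Finset.sum_le_sum fun k _ => hxr k
  -- `θ` separates the demands inside and outside `O`. It is the dual price of storage in the
  -- fractional knapsack problem and gives the bound object by object.
  obtain ⟨θ, hθ0, hθ1, hθ2⟩ : ∃ θ : ℝ, 0 ≤ θ ∧ (∀ k ∈ O, θ ≤ r k) ∧ ∀ k ∉ O, r k ≤ θ := by
    by_cases hne : (Finset.univ \ O).Nonempty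
    · obtain ⟨a, ha, hmax⟩ := Finset.exists_max_image _ r hne
      exact ⟨r a, hr a, fun k hk => htop k hk a (by simpa using ha),
        fun k hk => hmax k (by simpa using hk)⟩
    · refine ⟨0, le_rfl, fun k _ => hr k, fun k hk => ?_⟩
      exact absurd ⟨k, by simpa using hk⟩ hne
  have key : ∀ k, x k - (if k ∈ O then r k else 0) ≤ θ * (y k - if k ∈ O then 1 else 0) := by
    intro k
    by_cases hk : k ∈ O
    · simp only [hk, if_true]
      rcases le_total (y k) 1 with h | h
      · have := mul_nonneg (sub_nonneg.2 (hθ1 k hk)) (sub_nonneg.2 h)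
        linarith [hxy k]
      · have := mul_nonneg hθ0 (sub_nonneg.2 h)
        linarith [hxr k]
    · simp only [hk, if_false, sub_zero]
      exact (hxy k).trans (mul_le_mul_of_nonneg_right (hθ2 k hk) (hy k))
  have hsum := Finset.sum_le_sum fun k (_ : k ∈ Finset.univ) => key k
  rw [← Finset.mul_sum, Finset.sum_sub_distrib, Finset.sum_sub_distrib] at hsum
  simp only [Finset.sum_ite_mem, Finset.univ_inter, Finset.sum_const, nsmul_eq_mul,
    mul_one] at hsum
  have : θ * (∑ k, y k - O.card) ≤ 0 := mul_nonpos_of_nonneg_of_nonpos hθ0 (by linarith)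
  linarith

theorem localize_le_of_ne [DecidableEq ι] [DecidableEq κ] (I : CacheInstance ι κ)
    (O : ι → Finset κ) (x : Option ι → ι → κ → ℕ)
    {i : Option ι} {j : ι} (h : i ≠ some j) (k : κ) : I.localize O x i j k ≤ x i j k := by
  unfold localize
  split_ifs <;> simp

theorem serves_localize [Fintype ι] [DecidableEq ι] [DecidableEq κ] (I : CacheInstance ι κ)
    (O F : ι → Finset κ) (x : Option ι → ι → κ → ℕ)
    (hx : I.Serves F x) : I.Serves (fun i => F i ∪ O i) (I.localize O x) := by
  constructor
  · intro j k
    unfold localize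
    by_cases h : k ∈ O j
    · simp [h]
    · simp [h, hx.all_served]
  · intro i j k hne
    unfold localize at hne
    rw [Finset.mem_union]
    split_ifs at hne with h1 h2
    · rw [Option.some.inj h2]; exact Or.inr h1
    · exact absurd rfl hne
    · exact Or.inl (hx.stored i j k hne)

theorem uploaded_localize_le [Fintype ι] [Fintype κ] [DecidableEq ι] [DecidableEq κ]
    (I : CacheInstance ι κ) (O : ι → Finset κ)
    (x : Option ι → ι → κ → ℕ) (i : ι) : uploaded (I.localize O x) i ≤ uploaded x i := by
  refine Finset.sum_le_sum fun j hj => Finset.sum_le_sum fun k _ => I.localize_le_of_ne O x ?_ k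
  intro h
  exact (Finset.mem_filter.1 hj).2 (Option.some.inj h).symm

theorem serverLoad_localize_le [Fintype ι] [Fintype κ] [DecidableEq ι] [DecidableEq κ]
    (I : CacheInstance ι κ) (O : ι → Finset κ)
    (x : Option ι → ι → κ → ℕ) : serverLoad (I.localize O x) ≤ serverLoad x :=
  Finset.sum_le_sum fun _ _ => Finset.sum_le_sum fun k _ => I.localize_le_of_ne O x (by simp) k

/-- On both sides the downloads are bounded by, or equal to, total demand minus local service, so it
suffices to compare local service. -/
theorem downloaded_localize_le [Fintype ι] [Fintype κ] [DecidableEq ι] [DecidableEq κ]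
    (I : CacheInstance ι κ) (O F : ι → Finset κ)
    (x : Option ι → ι → κ → ℕ) (hx : I.Serves F x) (hO : I.IsTop O) (xh : Option ι → ι → κ → ℝ)
    (yh : ι → κ → ℝ) (hfeas : I.FracFeasible xh yh) (j : ι) :
    (downloaded (I.localize O x) j : ℝ) ≤ fracDownload xh j := by
  have hfrac : fracDownload xh j = ∑ k, (I.demand j k : ℝ) - ∑ k, xh (some j) j k := by
    rw [fracDownload, ← Finset.sum_sub_distrib]
    refine Finset.sum_congr rfl fun k _ => ?_
    rw [← hfeas.all_served j k, ← Finset.add_sum_erase _ _ (Finset.mem_univ (some j)),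
      Finset.filter_ne']
    ring
  have hint : downloaded (I.localize O x) j ≤ ∑ k, if k ∈ O j then 0 else I.demand j k := by
    refine Finset.sum_le_sum fun k _ => ?_
    split_ifs with h
    · refine (Finset.sum_eq_zero fun i hi => ?_).le
      simp [localize, h, (Finset.mem_filter.1 hi).2]
    · rw [← hx.all_served j k]
      refine le_trans (Finset.sum_le_sum fun i hi => ?_)
        (Finset.sum_le_sum_of_subset (Finset.filter_subset (fun i => i ≠ some j) _))
      exact I.localize_le_of_ne O x (Finset.mem_filter.1 hi).2 k
  have hsplit : ((∑ k, if k ∈ O j then 0 else I.demand j k : ℕ) : ℝ) =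
      ∑ k, (I.demand j k : ℝ) - ∑ k ∈ O j, (I.demand j k : ℝ) := by
    rw [eq_sub_iff_add_eq, ← Finset.univ_inter (O j), ← Finset.sum_ite_mem]
    push_cast
    rw [← Finset.sum_add_distrib]
    refine Finset.sum_congr rfl fun k _ => ?_
    split_ifs <;> simp_all
  have hlocal : ∑ k, xh (some j) j k ≤ ∑ k ∈ O j, (I.demand j k : ℝ) := by
    refine sum_local_le_sum_top _ _ (fun k => yh j k) (O j) (I.storage j)
      (fun k => Nat.cast_nonneg _) (fun k => ?_) (fun k => hfeas.stored j j k)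
      (fun k => hfeas.y_nonneg j k) (hfeas.storage_limit j) ?_ ?_
    · rw [← hfeas.all_served j k]
      exact Finset.single_le_sum (f := fun i => xh i j k) (fun i _ => hfeas.x_nonneg i j k)
        (Finset.mem_univ (some j))
    · have hcard := (hO j).1
      rcases min_choice (I.storage j) (Fintype.card κ) with h | h
      · right; rw [hcard, h]
      · left; exact (Finset.card_eq_iff_eq_univ _).1 (hcard.trans h)
    · intro k hk k' hk'
      exact_mod_cast (hO j).2 k hk k' hk'
  have : (downloaded (I.localize O x) j : ℝ) ≤
      ((∑ k, if k ∈ O j then 0 else I.demand j k : ℕ) : ℝ) := by exact_mod_cast hint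
  rw [hfrac]
  linarith

/-! ### Storage budget and the rounded placement -/

/-- Storage budget of a cache whose large entries have mass `B` and whose small entries have mass
`S`. -/
theorem storage_budget {s : ℕ} {B S m : ℝ} (hm : 0 ≤ m) (hmS : m ≤ 4 * S) (hBS : B + S ≤ s)
    (hB : B = 0 ∨ 1 / 2 ≤ B) :
    B + (⌈m⌉₊ : ℝ) ≤ 4 * s ∧ 2 * B + (⌈m⌉₊ : ℝ) ≤ 4 * s + 2 := by
  -- Without large entries, integrality of `4 * s` absorbs the ceiling. Otherwise large mass is
  -- charged once or twice instead of four times, which frees at least `2 * B ≥ 1`.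
  rcases hB with rfl | hB
  · have h : ⌈m⌉₊ ≤ 4 * s := Nat.ceil_le.2 (by push_cast; linarith)
    have h' : (⌈m⌉₊ : ℝ) ≤ 4 * s := by exact_mod_cast h
    constructor <;> linarith
  · have := Nat.ceil_lt_add_one hm
    constructor <;> linarith

/-- The copies obtained by rounding up the large entries and opening the small entries listed in
`opened`. -/
noncomputable def placedCopies [DecidableEq ι] (yh : ι → κ → ℝ) (opened : κ → Finset ι) (i : ι)
    (k : κ) : ℕ :=
  if 1 / 2 ≤ yh i k then ⌈yh i k⌉₊ else if i ∈ opened k then 1 else 0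

theorem mem_contents_placedCopies [Fintype κ] [DecidableEq ι] (yh : ι → κ → ℝ)
    (opened : κ → Finset ι) (i : ι) (k : κ) :
    k ∈ contents (placedCopies yh opened) i ↔ 1 / 2 ≤ yh i k ∨ i ∈ opened k := by
  unfold contents placedCopies
  rw [Finset.mem_filter]
  simp only [Finset.mem_univ, true_and]
  split_ifs with h1 h2
  · simp only [h1, true_or, iff_true, Nat.ceil_pos]
    linarith
  · simp [h2]
  · simp only [h1, h2, or_self, lt_irrefl]

theorem isRounding_placedCopies [Fintype ι] [DecidableEq ι] (yh : ι → κ → ℝ)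
    (opened : κ → Finset ι)
    (hsmall : ∀ k, ∀ i ∈ opened k, yh i k < 1 / 2) (hpos : ∀ k, ∀ i ∈ opened k, yh i k ≠ 0)
    (hcard : ∀ k, (opened k).card = smallCopies fun i => yh i k) :
    IsRounding yh (placedCopies yh opened) := by
  constructor
  · intro i k h
    exact if_pos h
  · intro i k h hmass
    have hempty : opened k = ∅ := by
      rw [← Finset.card_eq_zero, hcard, smallCopies]
      exact if_neg (not_le.2 hmass)
    rw [placedCopies, if_neg (not_le.2 h), hempty]
    simp
  · intro k hmass
    have hc : (opened k).card = ⌈smallMass yh k⌉₊ := by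
      rw [hcard, smallCopies]; exact if_pos hmass
    rw [← hc, Finset.card_eq_sum_ones, ← Finset.sum_subset (s₁ := opened k)]
    · refine Finset.sum_congr rfl fun i hi => ?_
      rw [placedCopies, if_neg (not_le.2 (hsmall k i hi)), if_pos hi]
    · intro i hi
      simpa using hsmall k i hi
    · intro i hi hno
      have : yh i k < 1 / 2 := (Finset.mem_filter.1 hi).2
      rw [placedCopies, if_neg (not_le.2 this), if_neg hno]
  · intro i k h
    rw [placedCopies, if_neg (by rw [h]; norm_num), if_neg (fun hi => hpos k i hi h)]

end CacheInstance

/-! ### The approximation theorem -/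

open CacheInstance

theorem mainTheorem6 {ι κ : Type*} [Fintype ι] [Fintype κ] [DecidableEq ι] [DecidableEq κ]
    (I : CacheInstance ι κ) (xh : Option ι → ι → κ → ℝ) (yh : ι → κ → ℝ)
    (hfeas : I.FracFeasible xh yh) :
    ∃ (y : ι → κ → ℕ) (x : Option ι → ι → κ → ℕ),
      CacheInstance.IsRounding yh y ∧
      I.Serves (CacheInstance.contents y) x ∧
      (∀ i, ∑ k, y i k ≤ 4 * I.storage i + 2) ∧
      (∀ i, (CacheInstance.uploaded x i : ℝ) ≤ 8 * (I.upload i : ℝ) + 4 * I.tauMax) ∧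
      ((CacheInstance.serverLoad x : ℝ) + (I.placementCost (CacheInstance.contents y) : ℝ)
        ≤ 16 * I.fracCost xh yh) ∧
      ∀ O : ι → Finset κ, I.IsTop O →
        I.Serves (fun i => CacheInstance.contents y i ∪ O i) (I.localize O x) ∧
        (∀ i, (CacheInstance.contents y i ∪ O i).card ≤ 5 * I.storage i + 2) ∧
        (∀ i, (CacheInstance.uploaded (I.localize O x) i : ℝ)
          ≤ 8 * (I.upload i : ℝ) + 4 * I.tauMax) ∧
        CacheInstance.serverLoad (I.localize O x) ≤ CacheInstance.serverLoad x ∧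
        ∀ j, (CacheInstance.downloaded (I.localize O x) j : ℝ)
          ≤ CacheInstance.fracDownload xh j := by
  classical
  have hobj : ∀ k, _ := fun k => exists_object_slots (fun i => I.tau i)
    (fun j => (I.demand j k : ℝ)) (fun i => yh i k) (fun i j => xh i j k) I.tau_nonneg
    (fun j => Nat.cast_nonneg _) (fun i j => hfeas.x_nonneg i j k) (fun i => hfeas.y_nonneg i k)
    (fun i => hfeas.copy_limit i k) (fun j => hfeas.all_served j k) (fun i j => hfeas.stored i j k)
  choose Z hZ0 hZrow hZ1 hZ4 hZsmall hZdem using hobj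
  obtain ⟨g, hginj, hgpos, hgcard, hgcost⟩ := exists_placement _ Z hZ0 hZrow hZ1
    (fun i k => if k ∈ I.prev i then 0 else 1) (fun i k => by split_ifs <;> norm_num)
  let m : ι → κ → ℝ := fun i k => ∑ t, Z k t i
  have hm0 : ∀ i k, 0 ≤ m i k := fun i k => Finset.sum_nonneg fun t _ => hZ0 k t i
  have hmbig : ∀ i k, ¬ yh i k < 1 / 2 → m i k = 0 := fun i k h =>
    Finset.sum_eq_zero fun t _ => le_antisymm (not_lt.1 fun hp => h (hZsmall k t i hp)) (hZ0 k t i)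
  let opened : κ → Finset ι := fun k => Finset.univ.image (g k)
  have hopened : ∀ i k, i ∈ opened k ↔ ∃ t, g k t = i := fun i k => by simp [opened]
  have hosmall : ∀ k, ∀ i ∈ opened k, yh i k < 1 / 2 := by
    intro k i hi
    obtain ⟨t, rfl⟩ := (hopened i k).1 hi
    exact hZsmall k t _ (hgpos k t)
  have hopos : ∀ k, ∀ i ∈ opened k, yh i k ≠ 0 := by
    intro k i hi h0
    obtain ⟨t, rfl⟩ := (hopened i k).1 hi
    have h1 := hZ4 k (g k t)
    have h2 := Finset.single_le_sum (f := fun t' => Z k t' (g k t)) (fun t' _ => hZ0 k t' _)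
      (Finset.mem_univ t)
    have h3 := hgpos k t
    rw [h0] at h1
    linarith
  set y := placedCopies yh opened with hydef
  have hcontents : ∀ i k, k ∈ contents y i ↔ 1 / 2 ≤ yh i k ∨ i ∈ opened k :=
    mem_contents_placedCopies yh opened
  have hround : IsRounding yh y := isRounding_placedCopies yh opened hosmall hopos fun k => by
    rw [Finset.card_image_of_injective _ (hginj k), Finset.card_univ, Fintype.card_fin]
  -- storage
  let count : ι → ℕ := fun i => (Finset.univ.filter fun k => i ∈ opened k).card
  let big : ι → ℝ := fun i => ∑ k with ¬ yh i k < 1 / 2, yh i k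
  have hbudget : ∀ i, big i + count i ≤ 4 * I.storage i ∧
      2 * big i + count i ≤ 4 * I.storage i + 2 := by
    intro i
    have hb := storage_budget (s := I.storage i) (B := big i)
      (S := ∑ k with yh i k < 1 / 2, yh i k) (m := ∑ k, m i k)
      (Finset.sum_nonneg fun k _ => hm0 i k)
      (by
        rw [Finset.sum_filter, Finset.mul_sum]
        refine Finset.sum_le_sum fun k _ => ?_
        split_ifs with h
        · exact hZ4 k i
        · simp [hmbig i k h])
      (by
        rw [add_comm]
        exact (Finset.sum_filter_add_sum_filter_not Finset.univ _ _).trans_le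
          (hfeas.storage_limit i))
      (by
        by_cases hne : (Finset.univ.filter fun k => ¬ yh i k < 1 / 2).Nonempty
        · right
          obtain ⟨k, hk⟩ := hne
          refine (not_lt.1 (Finset.mem_filter.1 hk).2).trans ?_
          exact Finset.single_le_sum (f := fun k => yh i k) (fun k _ => hfeas.y_nonneg i k) hk
        · left
          simp only [big, Finset.not_nonempty_iff_eq_empty.1 hne, Finset.sum_empty])
    have hc : (count i : ℝ) ≤ (⌈∑ k, m i k⌉₊ : ℝ) := by
      have := hgcard i
      simp only [← hopened] at this
      exact_mod_cast this
    exact ⟨by linarith [hb.1], by linarith [hb.2]⟩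
  have hstorage : ∀ i, ∑ k, y i k ≤ 4 * I.storage i + 2 := by
    intro i
    have h : ((∑ k, y i k : ℕ) : ℝ) ≤ 2 * big i + count i := by
      simp only [big, count, Finset.card_filter]
      push_cast
      rw [Finset.sum_filter, Finset.mul_sum, ← Finset.sum_add_distrib]
      refine Finset.sum_le_sum fun k _ => ?_
      by_cases hk : yh i k < 1 / 2
      · simp only [hydef, placedCopies, if_neg (not_le.2 hk), not_true, if_false, hk]
        simp
      · have hk' := not_lt.1 hk
        have hceil : (⌈yh i k⌉₊ : ℝ) ≤ 2 * yh i k := by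
          rcases le_or_gt (yh i k) 1 with h | h
          · have : ⌈yh i k⌉₊ ≤ 1 := Nat.ceil_le.2 (by simpa using h)
            have : (⌈yh i k⌉₊ : ℝ) ≤ 1 := by exact_mod_cast this
            linarith
          · have := Nat.ceil_lt_add_one (hfeas.y_nonneg i k)
            linarith
        simp only [hydef, placedCopies, if_pos hk', not_false_iff, if_true, hk]
        have : (0 : ℝ) ≤ if i ∈ opened k then 1 else 0 := by split_ifs <;> norm_num
        linarith
    have h' := h.trans (hbudget i).2
    exact_mod_cast h'
  -- routing
  let cap : ι → κ → ℝ := fun i k =>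
    2 * I.tau i * ((if i ∈ opened k then 1 else 0) + if ¬ yh i k < 1 / 2 then yh i k else 0)
  -- The capacities reproduce the right side of `hZdem`. At cache `i` they sum to `2 * τ i * (big i
  -- + count i) ≤ 8 * τ i * s i`, hence at most `8 * u i`.
  obtain ⟨x, hx1, hx2, hx3, hx4⟩ := exists_routing (contents y) I.demand (fun i => 8 * I.upload i)
    cap (fun k => 2 * ∑ j, xh none j k)
    (fun i k => by
      have := I.tau_nonneg i
      have := hfeas.y_nonneg i k
      simp only [cap]
      split_ifs <;> positivity)
    (fun k => mul_nonneg zero_le_two (Finset.sum_nonneg fun j _ => hfeas.x_nonneg _ _ _))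
    (fun i k hk => by
      rw [hcontents, not_or, not_le] at hk
      simp only [cap, hk.2, if_false, not_not.2 hk.1]
      simp)
    (fun i => by
      have h1 : ∑ k, cap i k = 2 * I.tau i * (big i + count i) := by
        simp only [cap, big, count, Finset.card_filter]
        rw [← Finset.mul_sum, Finset.sum_add_distrib, Finset.sum_filter]
        push_cast
        ring
      have h2 := mul_le_mul_of_nonneg_left (hbudget i).1 (I.tau_nonneg i)
      have h3 := I.tau_mul_storage_le i
      rw [h1]
      push_cast
      linarith)
    (fun k => by
      have h := hZdem k (g k) (hginj k) (hgpos k)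
      have h1 : (Finset.univ.filter fun j => k ∉ contents y j) =
          Finset.univ.filter fun j => yh j k < 1 / 2 ∧ ∀ t, g k t ≠ j := by
        refine Finset.filter_congr fun j _ => ?_
        rw [hcontents, hopened, not_or, not_le, not_exists]
      have h2 : ∑ i, cap i k = 2 * ∑ t, I.tau (g k t) +
          2 * ∑ i with ¬ yh i k < 1 / 2, I.tau i * yh i k := by
        have h3 : ∑ t, I.tau (g k t) = ∑ i, if i ∈ opened k then I.tau i else 0 := by
          rw [Finset.sum_ite_mem, Finset.univ_inter,
            Finset.sum_image (fun a _ b _ hab => hginj k hab)]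
        rw [h3, Finset.sum_filter, Finset.mul_sum, Finset.mul_sum, ← Finset.sum_add_distrib]
        refine Finset.sum_congr rfl fun i _ => ?_
        simp only [cap]
        split_ifs <;> ring
      rw [h1, h2]
      exact h)
  have hserves : I.Serves (contents y) x := ⟨hx1, hx2⟩
  have hupload : ∀ i, (uploaded x i : ℝ) ≤ 8 * (I.upload i : ℝ) + 4 * I.tauMax := by
    intro i
    -- The bound `8 * u i` holds outright; the term with `tauMax` is slack.
    have h1 : (uploaded x i : ℝ) ≤ 8 * (I.upload i : ℝ) := by exact_mod_cast hx3 i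
    linarith [I.tauMax_nonneg]
  refine ⟨y, x, hround, hserves, hstorage, hupload, ?_, ?_⟩
  · have hplace : (I.placementCost (contents y) : ℝ) ≤
        6 * ∑ i, ∑ k with k ∉ I.prev i, yh i k / (yh i k + 1) := by
      have h1 : (I.placementCost (contents y) : ℝ) ≤
          ∑ i, ∑ k, (if ¬ yh i k < 1 / 2 then (if k ∈ I.prev i then 0 else 1) else 0) +
          ∑ i, ∑ k with ∃ t, g k t = i, (if k ∈ I.prev i then (0 : ℝ) else 1) := by
        rw [placementCost, ← Finset.sum_add_distrib]
        push_cast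
        refine Finset.sum_le_sum fun i _ => ?_
        rw [Finset.sum_filter, ← Finset.sum_add_distrib, Finset.card_eq_sum_ones]
        push_cast
        rw [← Finset.univ_inter (contents y i \ I.prev i), ← Finset.sum_ite_mem]
        refine Finset.sum_le_sum fun k _ => ?_
        simp only [Finset.mem_sdiff, hcontents, hopened, ← not_lt]
        by_cases ha : yh i k < 1 / 2 <;> by_cases hb : ∃ t, g k t = i <;>
          by_cases hc : k ∈ I.prev i <;> simp only [ha, hb, hc] <;> norm_num
      refine h1.trans ((add_le_add_right hgcost _).trans ?_)
      rw [← Finset.sum_add_distrib, Finset.mul_sum]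
      refine Finset.sum_le_sum fun i _ => ?_
      rw [← Finset.sum_add_distrib, Finset.sum_filter, Finset.mul_sum]
      refine Finset.sum_le_sum fun k _ => ?_
      change _ + m i k * _ ≤ _
      have hy0 := hfeas.y_nonneg i k
      by_cases hc : k ∈ I.prev i
      · simp [hc]
      -- The constant 6 comes from small entries: `4 * y ≤ 6 * y / (y + 1)` exactly when `y ≤ 1/2`
      -- (for `y > 0`). For large entries `y / (y + 1) ≥ 1/3`.
      · by_cases ha : yh i k < 1 / 2
        · simp only [ha, hc, not_true, if_false, not_false_iff, if_true, zero_add, mul_one]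
          refine (hZ4 k i).trans ?_
          rw [mul_div_assoc', le_div_iff₀ (by linarith)]
          nlinarith
        · simp only [ha, hc, not_false_iff, if_true, if_false, hmbig i k ha, zero_mul, add_zero]
          rw [mul_div_assoc', le_div_iff₀ (by linarith)]
          linarith [not_lt.1 ha]
    have hsrv : ∑ k, 2 * ∑ j, xh none j k = 2 * ∑ j, ∑ k, xh none j k := by
      rw [← Finset.mul_sum, Finset.sum_comm]
    rw [hsrv] at hx4
    have hs0 : 0 ≤ ∑ j, ∑ k, xh none j k :=
      Finset.sum_nonneg fun j _ => Finset.sum_nonneg fun k _ => hfeas.x_nonneg _ _ _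
    have hp0 : 0 ≤ ∑ i, ∑ k with k ∉ I.prev i, yh i k / (yh i k + 1) :=
      Finset.sum_nonneg fun i _ => Finset.sum_nonneg fun k _ =>
        div_nonneg (hfeas.y_nonneg i k) (by linarith [hfeas.y_nonneg i k])
    rw [fracCost]
    linarith
  · intro O hO
    refine ⟨I.serves_localize O _ x hserves, fun i => ?_, fun i => ?_,
      I.serverLoad_localize_le O x, I.downloaded_localize_le O _ x hserves hO xh yh hfeas⟩
    · have h1 := Finset.card_union_le (contents y i) (O i)
      have h2 : (O i).card ≤ I.storage i := (hO i).1.trans_le (min_le_left _ _)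
      have h3 : (contents y i).card ≤ ∑ k, y i k := by
        rw [contents, Finset.card_filter]
        refine Finset.sum_le_sum fun k _ => ?_
        split_ifs with h
        · exact h
        · exact Nat.zero_le _
      have h4 := hstorage i
      omega
    · refine le_trans ?_ (hupload i)
      exact_mod_cast I.uploaded_localize_le O x i
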